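/- Let $1\le p<\infty$ and let $\mathbb{D}$ be the open unit disc of $\mathbb{C}$. Let $H^p(\mathbb{D})$ be the Hardy space of all holomorphic $f:\mathbb{D}\to\mathbb{C}$ with $$\|f\|_p=\Bigl(\sup_{0<r<1}\frac1{2\pi}\int_0^{2\pi}|f(re^{i\theta})|^p\,d\theta\Bigr)^{1/p}<\infty .$$ A bounded linear operator $T$ on a complex Banach space $X$ has the positive shadowing property if for every $\varepsilon>0$ there is $\delta>0$ such that for every sequence $(x_n)_{n\ge1}$ in $X$ with $\|Tx_n-x_{n+1}\|\le\delta$ for all $n\ge1$ there is $x\in X$ with $\|T^nx-x_n\|\le\varepsilon$ for all $n\ge1$. Let $\phi:\mathbb{D}\to\mathbb{D}$ be holomorphic. If $\phi$ has a fixed point in $\mathbb{D}$, then the (bounded) composition operator $C_\phi f=f\circ\phi$ does not have the positive shadowing property on $H^p(\mathbb{D})$. -/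

import Mathlib

noncomputable section

open Metric Set Real MeasureTheory

namespace HardyDisc

/-- The integral mean `(1 / 2π) ∫₀^{2π} |f (r e^{iθ})|^p dθ`. -/
def integralMean (p : ℝ) (f : ℂ → ℂ) (r : ℝ) : ℝ :=
  Real.circleAverage (fun z => ‖f z‖ ^ p) 0 r

/-- Membership in `H^p(𝔻)`: `f` is holomorphic on the open unit disc and its integral means over
the circles of radius `0 < r < 1` are bounded. A function on the disc is represented by its
extension by zero to `ℂ`, so that two members are equal iff they agree on the disc. -/
def MemHardy (p : ℝ) (f : ℂ → ℂ) : Prop :=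
  DifferentiableOn ℂ f (ball 0 1) ∧ (∀ z ∉ ball (0 : ℂ) 1, f z = 0) ∧
    BddAbove (integralMean p f '' Ioo 0 1)

/-- The norm `‖f‖_p = (sup_{0 < r < 1} (1 / 2π) ∫₀^{2π} |f (r e^{iθ})|^p dθ)^{1/p}`. -/
def hardyNorm (p : ℝ) (f : ℂ → ℂ) : ℝ :=
  (sSup (integralMean p f '' Ioo 0 1)) ^ (1 / p)

section Auxiliary

variable {p : ℝ} {f g : ℂ → ℂ} {r R : ℝ}

lemma sphere_subset (h0 : 0 < r) (h1 : r < 1) : sphere (0 : ℂ) |r| ⊆ ball 0 1 := by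
  intro z hz
  rw [abs_of_pos h0, mem_sphere_zero_iff_norm] at hz
  simpa [hz] using h1

lemma circleMap_mem (h0 : 0 < r) (h1 : r < 1) (θ : ℝ) : circleMap 0 r θ ∈ ball (0 : ℂ) 1 := by
  simpa [abs_of_pos h0] using h1

lemma continuous_circle (hf : DifferentiableOn ℂ f (ball 0 1)) (h0 : 0 < r) (h1 : r < 1) :
    Continuous fun θ => f (circleMap 0 r θ) :=
  hf.continuousOn.comp_continuous (continuous_circleMap 0 r) (circleMap_mem h0 h1)

lemma continuousOn_rpow (hp : 1 ≤ p) (hf : DifferentiableOn ℂ f (ball 0 1)) :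
    ContinuousOn (fun z => ‖f z‖ ^ p) (ball 0 1) :=
  hf.continuousOn.norm.rpow_const fun _ _ => Or.inr (by linarith)

lemma integralMean_nonneg : 0 ≤ integralMean p f r :=
  Real.circleAverage_nonneg_of_nonneg fun _ _ => by positivity

lemma integralMean_le (hf : MemHardy p f) (h0 : 0 < r) (h1 : r < 1) :
    integralMean p f r ≤ sSup (integralMean p f '' Ioo 0 1) :=
  le_csSup hf.2.2 ⟨r, ⟨h0, h1⟩, rfl⟩

lemma sSup_nonneg' : 0 ≤ sSup (integralMean p f '' Ioo 0 1) :=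
  Real.sSup_nonneg (by rintro _ ⟨r, _, rfl⟩; exact integralMean_nonneg)

lemma hardyNorm_nonneg : 0 ≤ hardyNorm p f := Real.rpow_nonneg sSup_nonneg' _

lemma hardyNorm_rpow (hp : 1 ≤ p) : hardyNorm p f ^ p = sSup (integralMean p f '' Ioo 0 1) := by
  rw [hardyNorm, ← Real.rpow_mul sSup_nonneg', one_div, inv_mul_cancel₀ (by linarith),
    Real.rpow_one]

lemma integralMean_le_norm (hp : 1 ≤ p) (hf : MemHardy p f) (h0 : 0 < r) (h1 : r < 1) :
    integralMean p f r ≤ hardyNorm p f ^ p :=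
  (integralMean_le hf h0 h1).trans (hardyNorm_rpow hp).ge

lemma hardyNorm_le_of (hp : 1 ≤ p) {C : ℝ} (hC : 0 ≤ C)
    (h : ∀ r, 0 < r → r < 1 → integralMean p f r ≤ C ^ p) : hardyNorm p f ≤ C := by
  have h2 : sSup (integralMean p f '' Ioo 0 1) ≤ C ^ p :=
    Real.sSup_le (by rintro _ ⟨r, hr, rfl⟩; exact h r hr.1 hr.2) (by positivity)
  calc hardyNorm p f ≤ (C ^ p) ^ (1 / p) :=
        Real.rpow_le_rpow sSup_nonneg' h2 (by positivity)
    _ = C := by rw [← Real.rpow_mul hC, mul_one_div_cancel (by linarith), Real.rpow_one]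

/-- Minkowski's inequality for the integral means. -/
lemma integralMean_add (hp : 1 ≤ p) (hf : DifferentiableOn ℂ f (ball 0 1))
    (hg : DifferentiableOn ℂ g (ball 0 1)) (h0 : 0 < r) (h1 : r < 1) :
    integralMean p (f + g) r ^ (1 / p) ≤
      integralMean p f r ^ (1 / p) + integralMean p g r ^ (1 / p) := by
  set q : ENNReal := ENNReal.ofReal p with hq
  have hp0 : 0 < p := by linarith
  have hqr : q.toReal = p := ENNReal.toReal_ofReal hp0.le
  have hq1 : 1 ≤ q := by rw [hq]; exact ENNReal.one_le_ofReal.2 hp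
  set μ : Measure ℝ := volume.restrict (Ioc 0 (2 * π)) with hμ
  have hmem : ∀ h : ℂ → ℂ, DifferentiableOn ℂ h (ball 0 1) →
      MemLp (fun θ => h (circleMap 0 r θ)) q μ := by
    intro h hh
    have hc := continuous_circle hh h0 h1
    obtain ⟨C, hC⟩ := (isCompact_Icc (a := (0 : ℝ)) (b := 2 * π)).exists_bound_of_continuousOn
      hc.continuousOn
    refine MemLp.of_bound hc.aestronglyMeasurable C ?_
    refine (ae_restrict_iff' measurableSet_Ioc).2 (ae_of_all _ fun θ hθ => ?_)
    exact hC θ ⟨hθ.1.le, hθ.2⟩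
  have key : ∀ h : ℂ → ℂ, DifferentiableOn ℂ h (ball 0 1) →
      integralMean p h r ^ (1 / p) = ((2 * π)⁻¹) ^ (1 / p) *
        (eLpNorm (fun θ => h (circleMap 0 r θ)) q μ).toReal := by
    intro h hh
    rw [(hmem h hh).eLpNorm_eq_integral_rpow_norm (by positivity) (by simp [hq]), hqr,
      ENNReal.toReal_ofReal (by positivity), integralMean, Real.circleAverage_def,
      intervalIntegral.integral_of_le (by positivity), smul_eq_mul,
      Real.mul_rpow (by positivity) (integral_nonneg fun _ => by positivity), one_div]
  rw [key _ hf, key _ hg, key _ (hf.add hg), ← mul_add]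
  refine mul_le_mul_of_nonneg_left ?_ (by positivity)
  rw [← ENNReal.toReal_add (hmem f hf).2.ne (hmem g hg).2.ne]
  exact ENNReal.toReal_mono (ENNReal.add_ne_top.2 ⟨(hmem f hf).2.ne, (hmem g hg).2.ne⟩)
    (eLpNorm_add_le (hmem f hf).1 (hmem g hg).1 hq1)

lemma integralMean_add_le (hp : 1 ≤ p) (hf : MemHardy p f) (hg : MemHardy p g)
    (h0 : 0 < r) (h1 : r < 1) :
    integralMean p (f + g) r ≤ (hardyNorm p f + hardyNorm p g) ^ p := by
  have h := integralMean_add hp hf.1 hg.1 h0 h1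
  have hp0 : 0 < p := by linarith
  have e : ∀ {h : ℂ → ℂ}, MemHardy p h → integralMean p h r ^ (1 / p) ≤ hardyNorm p h :=
    fun hh => Real.rpow_le_rpow integralMean_nonneg (integralMean_le hh h0 h1) (by positivity)
  have h2 := h.trans (add_le_add (e hf) (e hg))
  calc integralMean p (f + g) r = (integralMean p (f + g) r ^ (1 / p)) ^ p := by
        rw [← Real.rpow_mul integralMean_nonneg, one_div, inv_mul_cancel₀ hp0.ne', Real.rpow_one]
    _ ≤ _ := Real.rpow_le_rpow (Real.rpow_nonneg integralMean_nonneg _) h2 hp0.le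

lemma memHardy_add (hp : 1 ≤ p) (hf : MemHardy p f) (hg : MemHardy p g) : MemHardy p (f + g) := by
  refine ⟨hf.1.add hg.1, fun z hz => by simp [hf.2.1 z hz, hg.2.1 z hz], ?_⟩
  refine ⟨(hardyNorm p f + hardyNorm p g) ^ p, ?_⟩
  rintro _ ⟨r, hr, rfl⟩
  exact integralMean_add_le hp hf hg hr.1 hr.2

lemma integralMean_smul (c : ℂ) :
    integralMean p (c • f) r = ‖c‖ ^ p * integralMean p f r := by
  simp only [integralMean, Pi.smul_apply, norm_smul,
    Real.mul_rpow (norm_nonneg _) (norm_nonneg _)]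
  exact Real.circleAverage_fun_smul (a := ‖c‖ ^ p) (f := fun z => ‖f z‖ ^ p)

lemma hardyNorm_smul_le (hp : 1 ≤ p) (hf : MemHardy p f) (c : ℂ) :
    hardyNorm p (c • f) ≤ ‖c‖ * hardyNorm p f := by
  refine hardyNorm_le_of hp (mul_nonneg (norm_nonneg _) hardyNorm_nonneg) fun r h0 h1 => ?_
  rw [integralMean_smul, Real.mul_rpow (norm_nonneg _) hardyNorm_nonneg]
  exact mul_le_mul_of_nonneg_left (integralMean_le_norm hp hf h0 h1) (by positivity)

lemma memHardy_smul (hp : 1 ≤ p) (c : ℂ) (hf : MemHardy p f) : MemHardy p (c • f) := by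
  refine ⟨hf.1.const_smul c, fun z hz => by simp [hf.2.1 z hz], ?_⟩
  refine ⟨‖c‖ ^ p * hardyNorm p f ^ p, ?_⟩
  rintro _ ⟨r, hr, rfl⟩
  rw [integralMean_smul]
  exact mul_le_mul_of_nonneg_left (integralMean_le_norm hp hf hr.1 hr.2) (by positivity)

lemma integralMean_zero (hp : 1 ≤ p) : integralMean p 0 r = 0 := by
  simp [integralMean, Real.zero_rpow (show p ≠ 0 by linarith), Real.circleAverage_def]

lemma memHardy_zero (hp : 1 ≤ p) : MemHardy p 0 := by
  refine ⟨differentiableOn_const 0, fun _ _ => rfl, 0, ?_⟩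
  rintro _ ⟨r, _, rfl⟩
  exact (integralMean_zero hp).le

/-- The Poisson majorant of `|f|^p` on the disc of radius `R`, as the real part of a holomorphic
function. -/
def majorant (p : ℝ) (f : ℂ → ℂ) (R : ℝ) (w : ℂ) : ℂ :=
  Real.circleAverage (fun ζ => herglotzRieszKernel 0 w ζ • ((‖f ζ‖ ^ p : ℝ) : ℂ)) 0 R

lemma circleIntegrable_rpow (hp : 1 ≤ p) (hf : DifferentiableOn ℂ f (ball 0 1))
    (h0 : 0 < R) (h1 : R < 1) : CircleIntegrable (fun z => ‖f z‖ ^ p) 0 R :=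
  ((continuousOn_rpow hp hf).mono (sphere_subset h0 h1)).circleIntegrable'

lemma majorant_re (hp : 1 ≤ p) (hf : DifferentiableOn ℂ f (ball 0 1)) (h0 : 0 < R) (h1 : R < 1)
    {w : ℂ} (hw : w ∈ ball 0 R) : (majorant p f R w).re =
      Real.circleAverage (fun z => (herglotzRieszKernel 0 w z).re * ‖f z‖ ^ p) 0 R :=
  re_circleAverage_herglotzRieszKernel_smul (circleIntegrable_rpow hp hf h0 h1) hw

lemma majorant_differentiableOn (hp : 1 ≤ p) (hf : DifferentiableOn ℂ f (ball 0 1))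
    (h0 : 0 < R) (h1 : R < 1) : DifferentiableOn ℂ (majorant p f R) (ball 0 R) := by
  refine differentiableOn_circleAverage_herglotzRieszKernel_smul
    (f := fun ζ => ((‖f ζ‖ ^ p : ℝ) : ℂ)) ?_
  exact (Complex.continuous_ofReal.comp_continuousOn
    ((continuousOn_rpow hp hf).mono (sphere_subset h0 h1))).circleIntegrable'

lemma continuousOn_kernel {w : ℂ} (hw : w ∈ ball 0 R) :
    ContinuousOn (fun z => (herglotzRieszKernel 0 w z).re) (sphere 0 |R|) :=
  Complex.continuous_re.comp_continuousOn (continuousOn_herglotzRieszKernel_sphere hw)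

lemma kernel_nonneg (h0 : 0 < R) {w z : ℂ} (hw : w ∈ ball 0 R) (hz : z ∈ sphere 0 |R|) :
    0 ≤ (herglotzRieszKernel 0 w z).re := by
  rw [abs_of_pos h0] at hz
  refine le_trans ?_ (le_re_herglotzRieszKernel hz hw)
  have : ‖w - 0‖ < R := mem_ball_iff_norm.1 hw
  exact div_nonneg (by linarith) (by positivity)

lemma majorant_re_le (hp : 1 ≤ p) (hf : DifferentiableOn ℂ f (ball 0 1)) (h0 : 0 < R) (h1 : R < 1)
    {w : ℂ} (hw : w ∈ ball 0 R) :
    (majorant p f R w).re ≤ (R + ‖w‖) / (R - ‖w‖) * integralMean p f R := by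
  have hc := (continuousOn_rpow hp hf).mono (sphere_subset h0 h1)
  rw [majorant_re hp hf h0 h1 hw]
  have e : (R + ‖w‖) / (R - ‖w‖) * integralMean p f R =
      Real.circleAverage (fun z => (R + ‖w‖) / (R - ‖w‖) * ‖f z‖ ^ p) 0 R :=
    (Real.circleAverage_fun_smul (a := (R + ‖w‖) / (R - ‖w‖)) (f := fun z => ‖f z‖ ^ p)).symm
  rw [e]
  refine Real.circleAverage_mono ((continuousOn_kernel hw).mul hc).circleIntegrable'
    (continuousOn_const.mul hc).circleIntegrable' fun z hz => ?_
  rw [abs_of_pos h0] at hz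
  refine mul_le_mul_of_nonneg_right ?_ (by positivity)
  simpa [herglotzRieszKernel_def] using re_herglotzRieszKernel_le hz hw

/-- `|f|^p` is dominated by its Poisson majorant. -/
lemma rpow_le_majorant (hp : 1 ≤ p) (hf : DifferentiableOn ℂ f (ball 0 1))
    (h0 : 0 < R) (h1 : R < 1) {w : ℂ} (hw : w ∈ ball 0 R) :
    ‖f w‖ ^ p ≤ (majorant p f R w).re := by
  have hp0 : 0 < p := by linarith
  have hs := sphere_subset h0 h1
  have hc := (continuousOn_rpow hp hf).mono hs
  have hk := continuousOn_kernel hw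
  have hn := hf.continuousOn.norm.mono hs
  rw [majorant_re hp hf h0 h1 hw]
  rcases (norm_nonneg (f w)).eq_or_lt with hb | hb
  · rw [← hb, Real.zero_rpow hp0.ne']
    exact Real.circleAverage_nonneg_of_nonneg fun z hz =>
      mul_nonneg (kernel_nonneg h0 hw hz) (by positivity)
  have hone : Real.circleAverage (fun z => (herglotzRieszKernel 0 w z).re) 0 R = 1 := by
    have h := DiffContOnCl.circleAverage_re_herglotzRieszKernel_smul (f := fun _ : ℂ => (1 : ℂ))
      (c := 0) (R := R) (w := w) diffContOnCl_const hw
    have hci : CircleIntegrable ((Complex.re ∘ herglotzRieszKernel 0 w) • fun _ : ℂ => (1 : ℂ))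
        0 R := (hk.smul continuousOn_const).circleIntegrable'
    have h2 := Complex.reCLM.circleAverage_comp_comm hci
    rw [h] at h2
    rw [← Complex.one_re, ← Complex.reCLM_apply, ← h2]
    congr 1
    ext z
    simp
  have hmean : ‖f w‖ ≤ Real.circleAverage (fun z => (herglotzRieszKernel 0 w z).re * ‖f z‖) 0 R := by
    have hd : DiffContOnCl ℂ f (ball 0 R) := by
      refine (hf.mono ?_).diffContOnCl
      rw [closure_ball _ h0.ne']
      exact closedBall_subset_ball h1
    have h := hd.circleAverage_re_herglotzRieszKernel_smul hw
    rw [← h, Real.circleAverage_def, Real.circleAverage_def, norm_smul, smul_eq_mul,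
      Real.norm_of_nonneg (by positivity)]
    refine mul_le_mul_of_nonneg_left ?_ (by positivity)
    refine (intervalIntegral.norm_integral_le_integral_norm (by positivity)).trans_eq ?_
    refine intervalIntegral.integral_congr fun θ _ => ?_
    have := kernel_nonneg h0 hw (circleMap_mem_sphere' (0 : ℂ) R θ)
    simp [abs_of_nonneg this]
  set b := ‖f w‖ with hbdef
  have hint1 : CircleIntegrable
      (fun z => (b ^ p * (p / b)) • ((herglotzRieszKernel 0 w z).re * ‖f z‖)) 0 R :=
    ((continuousOn_const (c := b ^ p * (p / b))).smul (hk.mul hn)).circleIntegrable'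
  have hint2 : CircleIntegrable
      (fun z => (b ^ p * (1 - p)) • (herglotzRieszKernel 0 w z).re) 0 R :=
    ((continuousOn_const (c := b ^ p * (1 - p))).smul hk).circleIntegrable'
  have e1 : Real.circleAverage (fun z => (b ^ p * (p / b)) •
      ((herglotzRieszKernel 0 w z).re * ‖f z‖) +
        (b ^ p * (1 - p)) • (herglotzRieszKernel 0 w z).re) 0 R =
      b ^ p * (p / b) * Real.circleAverage
        (fun z => (herglotzRieszKernel 0 w z).re * ‖f z‖) 0 R + b ^ p * (1 - p) := by
    rw [Real.circleAverage_fun_add hint1 hint2, Real.circleAverage_fun_smul,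
      Real.circleAverage_fun_smul, hone]
    simp
  have e2 : b ^ p ≤ b ^ p * (p / b) * Real.circleAverage
        (fun z => (herglotzRieszKernel 0 w z).re * ‖f z‖) 0 R + b ^ p * (1 - p) := by
    have : b ^ p * (p / b) * b ≤ b ^ p * (p / b) * Real.circleAverage
        (fun z => (herglotzRieszKernel 0 w z).re * ‖f z‖) 0 R :=
      mul_le_mul_of_nonneg_left hmean (by positivity)
    have h3 : b ^ p * (p / b) * b = b ^ p * p := by field_simp
    linarith
  rw [← e1] at e2
  refine e2.trans (Real.circleAverage_mono (hint1.add hint2)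
    (hk.mul hc).circleIntegrable' fun z hz => ?_)
  have hK := kernel_nonneg h0 hw hz
  have hB : 1 + p * (‖f z‖ / b - 1) ≤ (‖f z‖ / b) ^ p := by
    have h4 : 0 ≤ ‖f z‖ / b := by positivity
    simpa using one_add_mul_self_le_rpow_one_add (s := ‖f z‖ / b - 1) (by linarith) hp
  rw [Real.div_rpow (norm_nonneg _) hb.le, le_div_iff₀ (by positivity)] at hB
  have := mul_le_mul_of_nonneg_left hB hK
  simp only [smul_eq_mul]
  refine le_trans (le_of_eq ?_) this
  field_simp
  ring

lemma rpow_le_integralMean (hp : 1 ≤ p) (hf : DifferentiableOn ℂ f (ball 0 1))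
    (h0 : 0 < R) (h1 : R < 1) {w : ℂ} (hw : w ∈ ball 0 R) :
    ‖f w‖ ^ p ≤ (R + ‖w‖) / (R - ‖w‖) * integralMean p f R :=
  (rpow_le_majorant hp hf h0 h1 hw).trans (majorant_re_le hp hf h0 h1 hw)

lemma eq_zero_of_hardyNorm (hp : 1 ≤ p) (hf : MemHardy p f) (h : hardyNorm p f = 0) : f = 0 := by
  ext w
  by_cases hw : w ∈ ball (0 : ℂ) 1
  · have hw1 : ‖w‖ < 1 := by simpa using hw
    obtain ⟨R, hR0, hR1⟩ := exists_between hw1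
    have hRp : 0 < R := (norm_nonneg w).trans_lt hR0
    have h1 := rpow_le_integralMean hp hf.1 hRp hR1 (by simpa using hR0)
    have h2 := integralMean_le_norm hp hf hRp hR1
    rw [h, Real.zero_rpow (by linarith)] at h2
    rw [le_antisymm h2 integralMean_nonneg, mul_zero] at h1
    have h3 := (Real.rpow_eq_zero (norm_nonneg (f w)) (by linarith)).1
      (le_antisymm h1 (by positivity))
    simpa using h3
  · exact hf.2.1 w hw

/-- Littlewood's subordination principle: composition with a holomorphic self-map of the disc
increases the integral means by at most a constant factor. -/
lemma integralMean_comp_le (hp : 1 ≤ p) (hf : MemHardy p f) {φ : ℂ → ℂ}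
    (hφ : DifferentiableOn ℂ φ (ball 0 1)) (hm : MapsTo φ (ball 0 1) (ball 0 1))
    (h0 : 0 < r) (h1 : r < 1) :
    integralMean p (f ∘ φ) r ≤ 4 / (1 - ‖φ 0‖) * hardyNorm p f ^ p := by
  have hsub : closedBall (0 : ℂ) r ⊆ ball 0 1 := closedBall_subset_ball h1
  obtain ⟨z₀, hz₀, hmax⟩ := (isCompact_closedBall (0 : ℂ) r).exists_isMaxOn
    ⟨0, by simpa using h0.le⟩ (hφ.continuousOn.norm.mono hsub)
  have hφz : ∀ z ∈ ball (0 : ℂ) 1, ‖φ z‖ < 1 := fun z hz => by simpa using hm hz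
  have hφ0 : ‖φ 0‖ < 1 := hφz 0 (by simp)
  obtain ⟨R, hR0, hR1⟩ : ∃ R, max ‖φ z₀‖ ((1 + ‖φ 0‖) / 2) < R ∧ R < 1 :=
    exists_between (max_lt (hφz _ (hsub hz₀)) (by linarith))
  obtain ⟨hRa, hRb⟩ := max_lt_iff.1 hR0
  have hRp : 0 < R := (norm_nonneg _).trans_lt hRa
  have hmR : MapsTo φ (closedBall 0 r) (ball 0 R) := fun z hz => by
    simpa using lt_of_le_of_lt (hmax hz) hRa
  have hG := (majorant_differentiableOn hp hf.1 hRp hR1).comp (hφ.mono hsub) hmR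
  have hGc : DiffContOnCl ℂ (majorant p f R ∘ φ) (ball 0 |r|) := by
    refine DifferentiableOn.diffContOnCl ?_
    rwa [abs_of_pos h0, closure_ball _ h0.ne']
  have hsr : sphere (0 : ℂ) |r| ⊆ closedBall 0 r := by
    rw [abs_of_pos h0]; exact sphere_subset_closedBall
  have hmv : Real.circleAverage (fun z => (majorant p f R (φ z)).re) 0 r =
      (majorant p f R (φ 0)).re := by
    have h := hGc.circleAverage
    have h2 := Complex.reCLM.circleAverage_comp_comm (f := majorant p f R ∘ φ) (c := 0) (R := r)
      (hG.continuousOn.mono hsr).circleIntegrable'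
    rw [h] at h2
    exact h2
  have hfφ : DifferentiableOn ℂ (f ∘ φ) (ball 0 1) := hf.1.comp hφ hm
  have hφ0R : φ 0 ∈ ball (0 : ℂ) R := hmR (by simpa using h0.le)
  calc integralMean p (f ∘ φ) r
      ≤ Real.circleAverage (fun z => (majorant p f R (φ z)).re) 0 r := by
        refine Real.circleAverage_mono (circleIntegrable_rpow hp hfφ h0 h1)
          (Complex.continuous_re.comp_continuousOn
            (hG.continuousOn.mono hsr)).circleIntegrable' fun z hz => ?_
        exact rpow_le_majorant hp hf.1 hRp hR1 (hmR (hsr hz))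
    _ = (majorant p f R (φ 0)).re := hmv
    _ ≤ (R + ‖φ 0‖) / (R - ‖φ 0‖) * integralMean p f R := majorant_re_le hp hf.1 hRp hR1 hφ0R
    _ ≤ 4 / (1 - ‖φ 0‖) * hardyNorm p f ^ p := by
        have h5 : 0 < R - ‖φ 0‖ := by linarith
        refine mul_le_mul ?_ (integralMean_le_norm hp hf hRp hR1) integralMean_nonneg
          (div_nonneg (by norm_num) (by linarith))
        rw [div_le_div_iff₀ h5 (by linarith)]
        nlinarith [norm_nonneg (φ 0)]

lemma integralMean_indicator (h0 : 0 < r) (h1 : r < 1) :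
    integralMean p ((ball 0 1).indicator f) r = integralMean p f r :=
  Real.circleAverage_congr_sphere fun z hz => by
    simp [indicator_of_mem (sphere_subset h0 h1 hz)]

lemma memHardy_comp (hp : 1 ≤ p) (hf : MemHardy p f) {φ : ℂ → ℂ}
    (hφ : DifferentiableOn ℂ φ (ball 0 1)) (hm : MapsTo φ (ball 0 1) (ball 0 1)) :
    MemHardy p ((ball 0 1).indicator (f ∘ φ)) := by
  refine ⟨(hf.1.comp hφ hm).congr fun z hz => indicator_of_mem hz _,
    fun z hz => indicator_of_notMem hz _, 4 / (1 - ‖φ 0‖) * hardyNorm p f ^ p, ?_⟩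
  rintro _ ⟨r, hr, rfl⟩
  rw [integralMean_indicator hr.1 hr.2]
  exact integralMean_comp_le hp hf hφ hm hr.1 hr.2

lemma hardyNorm_comp_le (hp : 1 ≤ p) (hf : MemHardy p f) {φ : ℂ → ℂ}
    (hφ : DifferentiableOn ℂ φ (ball 0 1)) (hm : MapsTo φ (ball 0 1) (ball 0 1)) :
    hardyNorm p ((ball 0 1).indicator (f ∘ φ)) ≤
      (4 / (1 - ‖φ 0‖)) ^ (1 / p) * hardyNorm p f := by
  have hφ0 : ‖φ 0‖ < 1 := by simpa using hm (show (0 : ℂ) ∈ ball 0 1 by simp)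
  have hC : 0 ≤ 4 / (1 - ‖φ 0‖) := div_nonneg (by norm_num) (by linarith)
  refine hardyNorm_le_of hp (mul_nonneg (by positivity) hardyNorm_nonneg) fun r h0 h1 => ?_
  rw [integralMean_indicator h0 h1, Real.mul_rpow (by positivity) hardyNorm_nonneg,
    ← Real.rpow_mul hC, one_div, inv_mul_cancel₀ (by linarith), Real.rpow_one]
  exact integralMean_comp_le hp hf hφ hm h0 h1

end Auxiliary

/-- `H^p(𝔻)` as a linear space of functions. -/
def hardySubmodule (p : ℝ) [hp : Fact (1 ≤ p)] : Submodule ℂ (ℂ → ℂ) where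
  carrier := {f | MemHardy p f}
  add_mem' := memHardy_add hp.out
  zero_mem' := memHardy_zero hp.out
  smul_mem' c _ := memHardy_smul hp.out c

/-- The Hardy space `H^p(𝔻)`, `1 ≤ p < ∞`, with the norm `hardyNorm p`. (A separate type, so that
it carries the topology of this norm and not the one of pointwise convergence.) -/
def HardySpace (p : ℝ) [Fact (1 ≤ p)] : Type := hardySubmodule p

namespace HardySpace

variable {p : ℝ} [hp : Fact (1 ≤ p)]

instance : AddCommGroup (HardySpace p) := inferInstanceAs (AddCommGroup (hardySubmodule p))

instance : Module ℂ (HardySpace p) := inferInstanceAs (Module ℂ (hardySubmodule p))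

instance : CoeFun (HardySpace p) fun _ => ℂ → ℂ := ⟨fun f => f.1⟩

instance : Norm (HardySpace p) := ⟨fun f => hardyNorm p f⟩

lemma normCore : NormedSpace.Core ℂ (HardySpace p) where
  norm_nonneg _ := hardyNorm_nonneg
  norm_smul c f := by
    refine le_antisymm (hardyNorm_smul_le hp.out f.2 c) ?_
    rcases eq_or_ne c 0 with rfl | hc
    · rw [norm_zero, zero_mul]; exact hardyNorm_nonneg
    · have h := hardyNorm_smul_le hp.out (memHardy_smul hp.out c f.2) c⁻¹
      rw [smul_smul, inv_mul_cancel₀ hc, one_smul, norm_inv] at h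
      have h2 := mul_le_mul_of_nonneg_left h (norm_nonneg c)
      rwa [mul_inv_cancel_left₀ (norm_ne_zero_iff.2 hc)] at h2
  norm_triangle f g := hardyNorm_le_of hp.out (add_nonneg hardyNorm_nonneg hardyNorm_nonneg)
    fun _ h0 h1 => integralMean_add_le hp.out f.2 g.2 h0 h1
  norm_eq_zero_iff f := by
    refine ⟨fun h => Subtype.ext (eq_zero_of_hardyNorm hp.out f.2 h), ?_⟩
    rintro rfl
    refine le_antisymm (hardyNorm_le_of hp.out le_rfl fun r _ _ => ?_) hardyNorm_nonneg
    exact (integralMean_zero hp.out).le.trans (by positivity)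

instance : NormedAddCommGroup (HardySpace p) := NormedAddCommGroup.ofCore normCore

instance : NormedSpace ℂ (HardySpace p) := NormedSpace.ofCore normCore

end HardySpace

/-- The composition operator `C_φ f = f ∘ φ` on `H^p(𝔻)` induced by a holomorphic self-map `φ` of
the open unit disc, as a bounded linear operator. -/
def compositionOperator (p : ℝ) [hp : Fact (1 ≤ p)] (φ : ℂ → ℂ)
    (hφ : DifferentiableOn ℂ φ (ball 0 1)) (hm : MapsTo φ (ball 0 1) (ball 0 1)) :
    HardySpace p →L[ℂ] HardySpace p :=
  LinearMap.mkContinuous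
    { toFun := fun f => ⟨(ball 0 1).indicator (f ∘ φ), memHardy_comp hp.out f.2 hφ hm⟩
      map_add' := fun f g => Subtype.ext (indicator_add (ball 0 1) (f ∘ φ) (g ∘ φ))
      map_smul' := fun c f => Subtype.ext (indicator_const_smul (ball 0 1) c (f ∘ φ)) }
    ((4 / (1 - ‖φ 0‖)) ^ (1 / p)) fun f => hardyNorm_comp_le hp.out f.2 hφ hm

end HardyDisc

section Shadowing

variable {X : Type*} [NormedAddCommGroup X] [NormedSpace ℂ X]

/-- `(x n)`, `n ≥ 1`, is a `δ`-pseudo-orbit of `T`; the value `x 0` plays no role. -/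
def IsPseudoOrbit (T : X →L[ℂ] X) (δ : ℝ) (x : ℕ → X) : Prop :=
  ∀ n, 1 ≤ n → ‖T (x n) - x (n + 1)‖ ≤ δ

/-- The positive shadowing property of a bounded linear operator. -/
def HasPositiveShadowing (T : X →L[ℂ] X) : Prop :=
  ∀ ε : ℝ, 0 < ε → ∃ δ : ℝ, 0 < δ ∧ ∀ x : ℕ → X, IsPseudoOrbit T δ x →
    ∃ y : X, ∀ n, 1 ≤ n → ‖(T ^ n) y - x n‖ ≤ ε

end Shadowing

end

namespace HardyDisc

/-! Suppose `φ α = α` with `α` in the disc. Two facts obstruct shadowing. The constant function `1`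
is a fixed vector of the composition operator (`compositionOperator_one`), and evaluation at `α` is
a functional invariant under the operator (`compositionOperator_pow_apply_of_fixed`), bounded by
`HardySpace.exists_norm_apply_le` and nonzero on that fixed vector. Since errors along a fixed
vector accumulate without being damped, the drift `n * t` times `1` is a pseudo-orbit for small `t >
0`, and its values at `α` tend to infinity. A true orbit keeps the same value at `α` forever, so
bounded evaluation prevents it from staying within a fixed distance of the drift. -/

/-- The constant function `1` on the disc belongs to `H^p(𝔻)`. -/
lemma memHardy_one (p : ℝ) : MemHardy p ((Metric.ball 0 1).indicator fun _ => 1) := by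
  refine ⟨(differentiableOn_const 1).congr fun z hz => Set.indicator_of_mem hz _,
    fun z hz => Set.indicator_of_notMem hz _, 1, ?_⟩
  rintro _ ⟨r, hr, rfl⟩
  rw [integralMean_indicator hr.1 hr.2]
  simp [integralMean, Real.circleAverage_const]

namespace HardySpace

variable {p : ℝ} [hp : Fact (1 ≤ p)]

/-- The constant function `1` as an element of `H^p(𝔻)`. -/
noncomputable def one (p : ℝ) [Fact (1 ≤ p)] : HardySpace p := ⟨_, memHardy_one p⟩

lemma one_apply {z : ℂ} (hz : z ∈ Metric.ball 0 1) : one p z = 1 :=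
  Set.indicator_of_mem hz fun _ => (1 : ℂ)

/-- Point evaluations on `H^p(𝔻)` are bounded. -/
lemma exists_norm_apply_le {w : ℂ} (hw : w ∈ Metric.ball 0 1) :
    ∃ C : ℝ, ∀ f : HardySpace p, ‖f w‖ ^ p ≤ C * ‖f‖ ^ p := by
  have hw1 : ‖w‖ < 1 := by simpa using hw
  obtain ⟨R, hR0, hR1⟩ := exists_between hw1
  have hRp : 0 < R := (norm_nonneg w).trans_lt hR0
  -- This is the Harnack bound for the Poisson kernel of the circle of radius `R`. As `R` depends
  -- only on `w`, it serves all `f` at once.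
  refine ⟨(R + ‖w‖) / (R - ‖w‖), fun f => ?_⟩
  refine (rpow_le_integralMean hp.out f.2.1 hRp hR1 (by simpa using hR0)).trans ?_
  exact mul_le_mul_of_nonneg_left (integralMean_le_norm hp.out f.2 hRp hR1)
    (div_nonneg (by positivity) (by linarith))

end HardySpace

section compositionOperator

variable {p : ℝ} [Fact (1 ≤ p)] {φ : ℂ → ℂ} (hφ : DifferentiableOn ℂ φ (Metric.ball 0 1))
  (hm : Set.MapsTo φ (Metric.ball 0 1) (Metric.ball 0 1))

lemma compositionOperator_apply (f : HardySpace p) {z : ℂ} (hz : z ∈ Metric.ball 0 1) :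
    compositionOperator p φ hφ hm f z = f (φ z) :=
  Set.indicator_of_mem hz _

lemma compositionOperator_one :
    compositionOperator p φ hφ hm (HardySpace.one p) = HardySpace.one p := by
  refine Subtype.ext (funext fun z => ?_)
  by_cases hz : z ∈ Metric.ball (0 : ℂ) 1
  · exact (compositionOperator_apply hφ hm _ hz).trans
      ((HardySpace.one_apply (hm hz)).trans (HardySpace.one_apply hz).symm)
  · exact (Set.indicator_of_notMem hz _).trans ((HardySpace.one p).2.2.1 z hz).symm

/-- Each application of the operator moves the evaluation point from `α` to `φ α = α`. In dual
terms, evaluation at `α` is an eigenvector of the adjoint with eigenvalue `1`. -/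
lemma compositionOperator_pow_apply_of_fixed {α : ℂ} (hα : α ∈ Metric.ball 0 1) (hfix : φ α = α)
    (f : HardySpace p) (n : ℕ) : (compositionOperator p φ hφ hm ^ n) f α = f α := by
  induction n with
  | zero => rfl
  | succ n ih =>
    -- The outermost factor is split off because it is the one that acts on the evaluation point.
    rw [pow_succ']
    exact (compositionOperator_apply hφ hm _ hα).trans ((congrArg _ hfix).trans ih)

end compositionOperator

end HardyDisc

open HardyDisc in
theorem mainTheorem10 (p : ℝ) [Fact (1 ≤ p)] (φ : ℂ → ℂ)
    (hφ : DifferentiableOn ℂ φ (Metric.ball 0 1))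
    (hm : Set.MapsTo φ (Metric.ball 0 1) (Metric.ball 0 1))
    (hfix : ∃ α ∈ Metric.ball (0 : ℂ) 1, φ α = α) :
    ¬ HasPositiveShadowing (HardyDisc.compositionOperator p φ hφ hm) := by
  obtain ⟨α, hα, hfix⟩ := hfix
  intro h
  -- Every `ε` fails; `1` is convenient because a norm at most `1` has `p`-th power at most `1`.
  obtain ⟨δ, hδ, h⟩ := h 1 one_pos
  have hp : 1 ≤ p := Fact.out
  have hN : 0 < ‖HardySpace.one p‖ + 1 := by positivity
  -- Each step of the drift has error `t * ‖1‖`, which must not exceed `δ`. The `+ 1` keeps the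
  -- denominator positive without computing the norm of `1`.
  set t : ℝ := δ / (‖HardySpace.one p‖ + 1) with ht
  have ht0 : 0 < t := div_pos hδ hN
  -- The constants `n * t` form a pseudo-orbit whose values at the fixed point are unbounded.
  obtain ⟨y, hy⟩ := h (fun n => ((n * t : ℝ) : ℂ) • HardySpace.one p) fun n _ => by
    rw [map_smul, compositionOperator_one, ← sub_smul, norm_smul, ← Complex.ofReal_sub,
      Complex.norm_real]
    have : (n * t - ((n + 1 : ℕ) : ℝ) * t) = -t := by push_cast; ring
    rw [this, norm_neg, Real.norm_of_nonneg ht0.le, ht, div_mul_eq_mul_div, div_le_iff₀ hN]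
    nlinarith
  obtain ⟨C, hC⟩ := HardySpace.exists_norm_apply_le (p := p) hα
  have hbound : ∀ n : ℕ, 1 ≤ n → n * t ≤ ‖y α‖ + (1 + |C|) := by
    intro n hn
    have h1 := hC ((compositionOperator p φ hφ hm ^ n) y -
      ((n * t : ℝ) : ℂ) • HardySpace.one p)
    have hval : ((compositionOperator p φ hφ hm ^ n) y -
        ((n * t : ℝ) : ℂ) • HardySpace.one p) α = y α - ((n * t : ℝ) : ℂ) := by
      -- The vector space operations of `HardySpace` are pointwise by definition.
      change (compositionOperator p φ hφ hm ^ n) y α -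
        ((n * t : ℝ) : ℂ) * HardySpace.one p α = _
      rw [compositionOperator_pow_apply_of_fixed hφ hm hα hfix, HardySpace.one_apply hα, mul_one]
    rw [hval] at h1
    -- The absolute value is needed since the sign of `C` is not part of the evaluation estimate.
    have h2 : ‖y α - ((n * t : ℝ) : ℂ)‖ ^ p ≤ |C| := by
      have h3 := Real.rpow_le_one (norm_nonneg _) (hy n hn) (by linarith : 0 ≤ p)
      refine h1.trans ((mul_le_mul_of_nonneg_right (le_abs_self C) (by positivity)).trans ?_)
      exact mul_le_of_le_one_right (abs_nonneg C) h3
    -- No `p`-th root is taken: a number `a ≥ 0` is either at most `1` or at most `a ^ p`, because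
    -- `p ≥ 1`.
    have h4 : ‖y α - ((n * t : ℝ) : ℂ)‖ ≤ 1 + |C| := by
      rcases le_total ‖y α - ((n * t : ℝ) : ℂ)‖ 1 with h5 | h5
      · linarith [abs_nonneg C]
      · linarith [Real.self_le_rpow_of_one_le h5 hp]
    have h6 := norm_sub_norm_le ((n * t : ℝ) : ℂ) (y α)
    rw [norm_sub_rev, Complex.norm_real, Real.norm_of_nonneg (by positivity)] at h6
    linarith
  obtain ⟨n, hn⟩ := exists_nat_gt ((‖y α‖ + (1 + |C|)) / t)
  rw [div_lt_iff₀ ht0] at hn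
  -- Shadowing says nothing at index `0`; passing to `n + 1` meets the requirement `1 ≤ n` and only
  -- enlarges the drift.
  have hb := hbound (n + 1) (by omega)
  push_cast at hb
  linarith
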